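/- Let $n$ and $r$ be positive integers. For each $i\in[n]=\{1,\dots,n\}$ take two $r$-element sets $D^+[i]$ and $D^-[i]$, all $2n$ of these sets being pairwise disjoint, and choose uniformly at random a perfect matching (bijection) between $D^+=\bigcup_{i=1}^n D^+[i]$ and $D^-=\bigcup_{i=1}^n D^-[i]$. Let $D^*(n,r)$ be the resulting random multidigraph on the vertex set $[n]$, which has one arc from $i$ to $j$ for each element of $D^+[i]$ that is matched with an element of $D^-[j]$. An oriented (simple) graph is a digraph without loops, parallel arcs, or digons (directed cycles of length two). **Lemma.** Fix a positive integer $r$ and, for every positive integer $i$, let $\mu_i=\dfrac{(2r-1)^i+1}{2i}$. Then $$\lim_{n\to\infty}\mathbb P\bigl(D^*(n,r)\text{ is an oriented (simple) graph}\bigr)=e^{-\mu_1-\mu_2}.$$ -/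

import Mathlib

open Filter Topology MeasureTheory

/-- A multidigraph with vertex set `V`, parallel arcs being indistinguishable and loops being
allowed: `mult i j` is the number of arcs from `i` to `j`. -/
@[ext]
structure Multidigraph (V : Type) where
  mult : V → V → ℕ

namespace Multidigraph

/-- No loops. -/
def Loopless {V : Type} (D : Multidigraph V) : Prop :=
  ∀ i, D.mult i i = 0

/-- No parallel arcs (two or more arcs with the same tail and the same head). -/
def NoParallelArcs {V : Type} (D : Multidigraph V) : Prop :=
  ∀ i j, D.mult i j ≤ 1

/-- A multidigraph is simple if it has no loops and no parallel arcs. -/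
def IsSimple {V : Type} (D : Multidigraph V) : Prop :=
  D.Loopless ∧ D.NoParallelArcs

/-- No digons (directed cycles of length two). -/
def DigonFree {V : Type} (D : Multidigraph V) : Prop :=
  ∀ i j, i ≠ j → ¬ (0 < D.mult i j ∧ 0 < D.mult j i)

/-- An oriented (simple) graph: a simple digraph without digons. -/
def IsOrientedGraph {V : Type} (D : Multidigraph V) : Prop :=
  D.IsSimple ∧ D.DigonFree

/-- Every set of multidigraphs is an event. -/
instance {V : Type} : MeasurableSpace (Multidigraph V) := ⊤

end Multidigraph

/-- The set `D⁺`, the disjoint union of the `r`-sets `D⁺[i] = {(i, k) | k}`, for `i` in `[n]`. -/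
abbrev OutPoint (n r : ℕ) : Type := Fin n × Fin r

/-- The set `D⁻`, the disjoint union of the `r`-sets `D⁻[i] = {(i, k) | k}`, for `i` in `[n]`. -/
abbrev InPoint (n r : ℕ) : Type := Fin n × Fin r

/-- A directed configuration: a pairing between the elements of `D⁺` and those of `D⁻`. -/
abbrev DirectedConfiguration (n r : ℕ) : Type := OutPoint n r ≃ InPoint n r

/-- The multidigraph of a directed configuration: there is one arc `ij` for each
`u ∈ D⁺[i]` that is paired with some `v ∈ D⁻[j]`. -/
def DirectedConfiguration.toMultidigraph {n r : ℕ} (c : DirectedConfiguration n r) :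
    Multidigraph (Fin n) where
  mult i j := (Finset.univ.filter (fun u : OutPoint n r => u.1 = i ∧ (c u).1 = j)).card

/-- The directed configuration model `D*(n,r)`: the law of the multidigraph of a uniformly
random directed configuration. -/
noncomputable def directedConfigurationModel (n r : ℕ) : PMF (Multidigraph (Fin n)) :=
  (PMF.uniformOfFintype (DirectedConfiguration n r)).map DirectedConfiguration.toMultidigraph

/-- `μ_i = ((2r - 1)^i + 1) / (2i)`, for `i ≥ 1`; the subtraction is in `ℝ`. -/
noncomputable def cycleMean (r i : ℕ) : ℝ :=
  ((2 * (r : ℝ) - 1) ^ i + 1) / (2 * (i : ℝ))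

/-! A configuration is a permutation `c` of N = nr points. Its multidigraph is an oriented graph
exactly when `c` has no loop and no clashing pair, that is, no two non-loop arcs that are parallel
or antiparallel. Let W be twice the number of these structures (clashing pairs are counted as
ordered pairs). Asymptotically W/2 is Poisson with mean r + d/2, where d = (r-1)² + r² is the number
of possible partners of a non-loop arc; here r = μ₁ and d/2 = μ₂.

The tool is switching: `c * swap u x` exchanges the heads of the arcs at `u` and `x`, which is a
bijection on permutations. Double counting (`sum_loop_switch`, `sum_pair_switch`) turns a sum over
permutations with a marked structure into a sum over switchings that create one. A typical such
switching raises W by exactly 2, whence k P(W = k) = (2r + d) P(W = k - 2) + O(1/N)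
(`abs_mul_prob_sub_le`). The atypical ones are controlled by the first two moments of W, bounded by
the same double counting (`sum_weight_mul_le`).

The recursion expresses every mass asymptotically through P(W = 0). Markov's inequality keeps mass
from escaping to infinity, so total mass 1 forces P(W = 0) to tend to exp(-(r + d/2))
(`tendsto_zero_mass`). -/

/-- Weights on single arcs `(u, v)` and on ordered pairs of arcs `(u, v)`, `(u', v')`, with values
in `{0, 1}`, marking the forbidden arcs and the forbidden pairs of arcs of a permutation. -/
structure SwitchPattern (Ω : Type*) [Fintype Ω] [DecidableEq Ω] (r d K : ℕ) where
  L : Ω → Ω → ℕ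
  R : Ω → Ω → Ω → Ω → ℕ
  L_le : ∀ u v, L u v ≤ 1
  R_le : ∀ u v u' v', R u v u' v' ≤ 1
  L_row : ∀ u, ∑ v, L u v = r
  L_col : ∀ v, ∑ u, L u v = r
  R_symm : ∀ u v u' v', R u v u' v' = R u' v' u v
  R_mul_L : ∀ u v u' v', R u v u' v' * L u v = 0
  R_tail : ∀ u v v', R u v u v' = 0
  R_head : ∀ u v u', R u v u' v = 0
  -- A forbidden arc has no partner and any other arc has exactly `d`. The bounds `K` below enter
  -- only the error terms.
  R_sum : ∀ u v, ∑ u', ∑ v', R u v u' v' + d * L u v = d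
  R_out : ∀ (c : Equiv.Perm Ω) w, ∑ u, ∑ x, R u (c u) w (c x) ≤ K
  R_in : ∀ (c : Equiv.Perm Ω) x, ∑ u, ∑ w, R u (c u) w (c x) ≤ K

/-! ### Switchings and moments of the weight -/

namespace SwitchPattern

variable {Ω : Type*} [Fintype Ω] [DecidableEq Ω] {r d K : ℕ} (S : SwitchPattern Ω r d K)

/-- The number of forbidden arcs of `c`. -/
def loops (c : Equiv.Perm Ω) : ℕ := ∑ u, S.L u (c u)

/-- The number of arcs of `c` forming a forbidden pair with the arc at `u`. -/
def nbr (c : Equiv.Perm Ω) (u : Ω) : ℕ := ∑ w, S.R u (c u) w (c w)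

/-- The number of ordered forbidden pairs of arcs of `c`. -/
def pairs (c : Equiv.Perm Ω) : ℕ := ∑ u, S.nbr c u

/-- The weighted number of forbidden structures in `c`. -/
def weight (c : Equiv.Perm Ω) : ℕ := 2 * S.loops c + S.pairs c

/-- The contribution to the weight of the structures that contain the arc at `u`. -/
def deg (c : Equiv.Perm Ω) (u : Ω) : ℕ := 2 * S.L u (c u) + 2 * S.nbr c u

/-- The weight of the structures that avoid the arcs at `u` and `x`. -/
def rest (c : Equiv.Perm Ω) (u x : Ω) : ℕ :=
  2 * ∑ z ∈ {u, x}ᶜ, S.L z (c z) + ∑ z ∈ {u, x}ᶜ, ∑ w ∈ {u, x}ᶜ, S.R z (c z) w (c w)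

/-- A forbidden pair made of the arcs at `u` and `x` themselves is counted in both degrees, hence
the correction on the left. -/
lemma weight_add (c : Equiv.Perm Ω) {u x : Ω} (h : u ≠ x) :
    S.weight c + 2 * S.R u (c u) x (c x) = S.rest c u x + S.deg c u + S.deg c x := by
  have key : ∀ f : Ω → ℕ, ∑ z, f z = f u + f x + ∑ z ∈ {u, x}ᶜ, f z := by
    intro f
    rw [← Finset.sum_add_sum_compl {u, x} f, Finset.sum_pair h]
  have hs : ∀ y, ∑ z ∈ {u, x}ᶜ, S.R z (c z) y (c y) = ∑ z ∈ {u, x}ᶜ, S.R y (c y) z (c z) :=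
    fun y => Finset.sum_congr rfl fun z _ => S.R_symm _ _ _ _
  simp only [weight, loops, pairs, deg, nbr, rest, key, Finset.sum_add_distrib, S.R_tail]
  rw [hs u, hs x, S.R_symm x (c x) u (c u)]
  ring

lemma rest_switch (c : Equiv.Perm Ω) (u x : Ω) :
    S.rest (c * Equiv.swap u x) u x = S.rest c u x := by
  have key : ∀ z ∈ ({u, x}ᶜ : Finset Ω), (c * Equiv.swap u x) z = c z := by
    intro z hz
    simp only [Finset.mem_compl, Finset.mem_insert, Finset.mem_singleton, not_or] at hz
    rw [Equiv.Perm.mul_apply, Equiv.swap_apply_of_ne_of_ne hz.1 hz.2]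
  unfold rest
  congr 1
  · congr 1
    exact Finset.sum_congr rfl fun z hz => by rw [key z hz]
  · exact Finset.sum_congr rfl fun z hz => Finset.sum_congr rfl fun w hw => by
      rw [key z hz, key w hw]

lemma R_le_nbr (c : Equiv.Perm Ω) (u x : Ω) : S.R u (c u) x (c x) ≤ S.nbr c u :=
  Finset.single_le_sum (f := fun w => S.R u (c u) w (c w)) (fun _ _ => Nat.zero_le _)
    (Finset.mem_univ x)

/-- Structures avoiding both arcs are untouched, and since `x` has degree 0 before and after, the
two arcs never form a forbidden pair. -/
lemma weight_switch (c : Equiv.Perm Ω) (u x : Ω) (h : S.deg c x = 0)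
    (h' : S.deg (c * Equiv.swap u x) x = 0) :
    S.weight (c * Equiv.swap u x) + S.deg c u = S.weight c + S.deg (c * Equiv.swap u x) u := by
  rcases eq_or_ne u x with rfl | hne
  · simp [← Equiv.Perm.one_def]
  have h1 := S.weight_add c hne
  have h2 := S.weight_add (c * Equiv.swap u x) hne
  rw [S.rest_switch] at h2
  have h3 := S.R_le_nbr c x u
  have h4 := S.R_le_nbr (c * Equiv.swap u x) x u
  rw [S.R_symm] at h3 h4
  have h5 : S.nbr c x = 0 := by unfold deg at h; omega
  have h6 : S.nbr (c * Equiv.swap u x) x = 0 := by unfold deg at h'; omega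
  omega

lemma R_row_le (u v : Ω) : ∑ u', ∑ v', S.R u v u' v' ≤ d :=
  (Nat.le_add_right _ _).trans (S.R_sum u v).le

lemma R_row_perm (c : Equiv.Perm Ω) (u v : Ω) :
    ∑ w, ∑ x, S.R u v w (c x) = ∑ w, ∑ y, S.R u v w y :=
  Finset.sum_congr rfl fun w _ => Equiv.sum_comp c (fun y => S.R u v w y)

lemma nbr_le (c : Equiv.Perm Ω) (u : Ω) : S.nbr c u ≤ d := by
  refine le_trans ?_ (S.R_row_le u (c u))
  exact Finset.sum_le_sum fun w _ =>
    Finset.single_le_sum (f := fun y => S.R u (c u) w y) (fun _ _ => Nat.zero_le _)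
      (Finset.mem_univ (c w))

lemma deg_le (c : Equiv.Perm Ω) (u : Ω) : S.deg c u ≤ 2 + 2 * d := by
  have h1 := S.L_le u (c u)
  have h2 := S.nbr_le c u
  unfold deg
  omega

lemma weight_switch_le (c : Equiv.Perm Ω) (u x : Ω) :
    S.weight (c * Equiv.swap u x) ≤ S.weight c + (4 + 4 * d) := by
  rcases eq_or_ne u x with rfl | hne
  · simp [← Equiv.Perm.one_def]
  have h1 := S.weight_add c hne
  have h2 := S.weight_add (c * Equiv.swap u x) hne
  rw [S.rest_switch] at h2
  have h3 := S.R_le_nbr c u x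
  have h5 := S.deg_le (c * Equiv.swap u x) u
  have h6 := S.deg_le (c * Equiv.swap u x) x
  have h7 : 2 * S.nbr c u ≤ S.deg c u := by unfold deg; omega
  omega

lemma sum_deg_le (c : Equiv.Perm Ω) : ∑ u, S.deg c u ≤ 2 * S.weight c := by
  simp only [deg, weight, loops, pairs, Finset.sum_add_distrib, ← Finset.mul_sum]
  omega

/-- Reindexing a sum over permutations by a switching. -/
lemma sum_switch (u x : Ω) (H : Equiv.Perm Ω → ℕ) :
    ∑ c, H (c * Equiv.swap u x) = ∑ c, H c :=
  Equiv.sum_comp (Equiv.mulRight (Equiv.swap u x)) H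

/-- The substitution of `c * swap u x` for `c` is an involution that turns `L u (c x)` into `L u (c
u)`. The left side runs over the switchings that create a forbidden arc at `u`. -/
lemma sum_loop_switch (G : Equiv.Perm Ω → Ω → ℕ) :
    ∑ c : Equiv.Perm Ω, ∑ u, ∑ x, S.L u (c x) * G (c * Equiv.swap u x) x =
      ∑ c : Equiv.Perm Ω, S.loops c * ∑ x, G c x := by
  have h : ∀ c : Equiv.Perm Ω, S.loops c * ∑ x, G c x = ∑ u, ∑ x, S.L u (c u) * G c x := by
    intro c
    rw [loops, Finset.sum_mul_sum]
  simp only [h]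
  rw [Finset.sum_comm, Finset.sum_comm (s := Finset.univ (α := Equiv.Perm Ω))]
  refine Finset.sum_congr rfl fun u _ => ?_
  rw [Finset.sum_comm, Finset.sum_comm (s := Finset.univ (α := Equiv.Perm Ω))]
  refine Finset.sum_congr rfl fun x _ => ?_
  rw [← sum_switch u x (fun c => S.L u (c u) * G c x)]
  simp

/-- The arc at `u` must stay put while the arc at `w` receives the head `c x`. This needs `x ≠ u`:
nothing is lost on the left, by `R_head`, but only N - 1 choices of `x` remain on the right. -/
lemma sum_pair_switch (G : Equiv.Perm Ω → Ω → Ω → ℕ) :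
    ∑ c : Equiv.Perm Ω, ∑ u, ∑ w, ∑ x, S.R u (c u) w (c x) * G (c * Equiv.swap w x) w x =
      ∑ c : Equiv.Perm Ω, ∑ u, ∑ w, ∑ x ∈ {u}ᶜ, S.R u (c u) w (c w) * G c w x := by
  have h : ∀ c : Equiv.Perm Ω, ∀ u w,
      ∑ x, S.R u (c u) w (c x) * G (c * Equiv.swap w x) w x =
      ∑ x ∈ {u}ᶜ, S.R u (c u) w (c x) * G (c * Equiv.swap w x) w x := by
    intro c u w
    rw [← Finset.sum_add_sum_compl {u}, Finset.sum_singleton, S.R_head, zero_mul, zero_add]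
  simp only [h]
  rw [Finset.sum_comm, Finset.sum_comm (s := Finset.univ (α := Equiv.Perm Ω))]
  refine Finset.sum_congr rfl fun u _ => ?_
  rw [Finset.sum_comm, Finset.sum_comm (s := Finset.univ (α := Equiv.Perm Ω))]
  refine Finset.sum_congr rfl fun w _ => ?_
  rw [Finset.sum_comm, Finset.sum_comm (s := Finset.univ (α := Equiv.Perm Ω))]
  refine Finset.sum_congr rfl fun x hx => ?_
  rw [← sum_switch w x (fun c => S.R u (c u) w (c w) * G c w x)]
  rcases eq_or_ne u w with rfl | hne
  · simp [S.R_tail]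
  · have hxu : u ≠ x := by
      rintro rfl
      simp at hx
    simp [Equiv.swap_apply_of_ne_of_ne hne hxu]

lemma sum_pair_switch' (G : Equiv.Perm Ω → ℕ) :
    ∑ c : Equiv.Perm Ω, ∑ u, ∑ w, ∑ x, S.R u (c u) w (c x) * G (c * Equiv.swap w x) =
      (Fintype.card Ω - 1) * ∑ c : Equiv.Perm Ω, S.pairs c * G c := by
  rw [S.sum_pair_switch (fun c _ _ => G c), Finset.mul_sum]
  refine Finset.sum_congr rfl fun c _ => ?_
  simp only [Finset.sum_const, smul_eq_mul, Finset.card_compl, Finset.card_singleton,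
    ← Finset.mul_sum, ← Finset.sum_mul, pairs, nbr]

lemma sum_loop_row (c : Equiv.Perm Ω) (g : Ω → ℕ) :
    ∑ u, ∑ x, S.L u (c x) * g u = r * ∑ u, g u := by
  rw [Finset.mul_sum]
  refine Finset.sum_congr rfl fun u _ => ?_
  rw [← Finset.sum_mul, Equiv.sum_comp c (fun v => S.L u v), S.L_row]

lemma sum_loop_col (c : Equiv.Perm Ω) (g : Ω → ℕ) :
    ∑ u, ∑ x, S.L u (c x) * g x = r * ∑ u, g u := by
  rw [Finset.sum_comm, Finset.mul_sum]
  refine Finset.sum_congr rfl fun u _ => ?_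
  rw [← Finset.sum_mul, S.L_col]

lemma sum_loop_const (c : Equiv.Perm Ω) (a : ℕ) :
    ∑ u, ∑ x, S.L u (c x) * a = r * (Fintype.card Ω * a) := by
  rw [S.sum_loop_row c (fun _ => a)]
  simp

lemma sum_pair_out_le (c : Equiv.Perm Ω) (g : Ω → ℕ) :
    ∑ u, ∑ w, ∑ x, S.R u (c u) w (c x) * g w ≤ K * ∑ w, g w := by
  rw [Finset.sum_comm, Finset.mul_sum]
  refine Finset.sum_le_sum fun w _ => ?_
  simp only [← Finset.sum_mul]
  exact Nat.mul_le_mul_right _ (S.R_out c w)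

lemma sum_pair_in_le (c : Equiv.Perm Ω) (g : Ω → ℕ) :
    ∑ u, ∑ w, ∑ x, S.R u (c u) w (c x) * g x ≤ K * ∑ x, g x := by
  have : ∑ u, ∑ w, ∑ x, S.R u (c u) w (c x) * g x =
      ∑ x, ∑ u, ∑ w, S.R u (c u) w (c x) * g x := by
    rw [Finset.sum_comm (s := Finset.univ (α := Ω)) (t := Finset.univ (α := Ω))]
    rw [Finset.sum_comm]
    conv_lhs => enter [2, u]; rw [Finset.sum_comm]
    rw [Finset.sum_comm]
  rw [this, Finset.mul_sum]
  refine Finset.sum_le_sum fun x _ => ?_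
  simp only [← Finset.sum_mul]
  exact Nat.mul_le_mul_right _ (S.R_in c x)

lemma sum_pair_const (c : Equiv.Perm Ω) (a : ℕ) :
    ∑ u, ∑ w, ∑ x, S.R u (c u) w (c x) * a + d * (S.loops c * a) =
      d * (Fintype.card Ω * a) := by
  have h : ∀ u, ∑ w, ∑ x, S.R u (c u) w (c x) * a + d * (S.L u (c u) * a) = d * a := by
    intro u
    simp only [← Finset.sum_mul]
    rw [S.R_row_perm, ← mul_assoc, ← add_mul, S.R_sum]
  rw [loops, Finset.sum_mul, Finset.mul_sum, ← Finset.sum_add_distrib]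
  simp only [h]
  simp
  ring

lemma sum_pair_const_le (c : Equiv.Perm Ω) (a : ℕ) :
    ∑ u, ∑ w, ∑ x, S.R u (c u) w (c x) * a ≤ d * (Fintype.card Ω * a) :=
  (Nat.le_add_right _ _).trans (S.sum_pair_const c a).le

/-- The total weighted moment bound: the weight is at most `4 + 4 d` larger after a switching. -/
lemma sum_weight_mul_le (hN : 2 ≤ Fintype.card Ω) (F G : Equiv.Perm Ω → ℕ)
    (h : ∀ c u x, F (c * Equiv.swap u x) ≤ G c) :
    ∑ c, S.weight c * F c ≤ (2 * r + 2 * d) * ∑ c, G c := by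
  have h1 : Fintype.card Ω * ∑ c, S.loops c * F c ≤ Fintype.card Ω * (r * ∑ c, G c) := by
    have e := S.sum_loop_switch (fun c _ => F c)
    simp only [Finset.sum_const, smul_eq_mul, Finset.card_univ] at e
    calc Fintype.card Ω * ∑ c, S.loops c * F c
        = ∑ c : Equiv.Perm Ω, ∑ u, ∑ x, S.L u (c x) * F (c * Equiv.swap u x) := by
          rw [e, Finset.mul_sum]
          exact Finset.sum_congr rfl fun c _ => by ring
      _ ≤ ∑ c : Equiv.Perm Ω, ∑ u, ∑ x, S.L u (c x) * G c := by
          gcongr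
          exact h _ _ _
      _ = Fintype.card Ω * (r * ∑ c, G c) := by
          simp only [S.sum_loop_const, ← Finset.mul_sum]
          ring
  have h2 : (Fintype.card Ω - 1) * ∑ c, S.pairs c * F c ≤
      (Fintype.card Ω - 1) * (2 * d * ∑ c, G c) := by
    rw [← S.sum_pair_switch']
    calc ∑ c : Equiv.Perm Ω, ∑ u, ∑ w, ∑ x, S.R u (c u) w (c x) * F (c * Equiv.swap w x)
        ≤ ∑ c : Equiv.Perm Ω, ∑ u, ∑ w, ∑ x, S.R u (c u) w (c x) * G c := by
          gcongr
          exact h _ _ _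
      _ ≤ ∑ c : Equiv.Perm Ω, d * (Fintype.card Ω * G c) :=
          Finset.sum_le_sum fun c _ => S.sum_pair_const_le c _
      _ = Fintype.card Ω * (d * ∑ c, G c) := by
          simp only [← Finset.mul_sum]
          ring
      -- N ≤ 2(N - 1) absorbs the lost choice of `x`; this doubles the constant `d`.
      _ ≤ ((Fintype.card Ω - 1) * 2) * (d * ∑ c, G c) := by
          gcongr
          omega
      _ = _ := by ring
  have h3 := Nat.le_of_mul_le_mul_left h1 (by omega)
  have h4 := Nat.le_of_mul_le_mul_left h2 (by omega)
  calc ∑ c, S.weight c * F c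
      = 2 * ∑ c, S.loops c * F c + ∑ c, S.pairs c * F c := by
        rw [Finset.mul_sum, ← Finset.sum_add_distrib]
        exact Finset.sum_congr rfl fun c _ => by rw [weight]; ring
    _ ≤ 2 * (r * ∑ c, G c) + 2 * d * ∑ c, G c := by gcongr
    _ = _ := by ring

lemma sum_weight_le (hN : 2 ≤ Fintype.card Ω) :
    ∑ c, S.weight c ≤ (2 * r + 2 * d) * (Fintype.card Ω).factorial := by
  simpa [Fintype.card_perm] using S.sum_weight_mul_le hN (fun _ => 1) (fun _ => 1) (by simp)

lemma sum_weight_sq_le (hN : 2 ≤ Fintype.card Ω) :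
    ∑ c, S.weight c * S.weight c ≤
      (2 * r + 2 * d) * (2 * r + 6 * d + 4) * (Fintype.card Ω).factorial := by
  refine (S.sum_weight_mul_le hN S.weight (fun c => S.weight c + (4 + 4 * d))
    S.weight_switch_le).trans ?_
  rw [Finset.sum_add_distrib, mul_assoc]
  gcongr
  have := S.sum_weight_le hN
  simp [Fintype.card_perm]
  nlinarith

end SwitchPattern

/-! ### The approximate recursion for the weight distribution -/

namespace SwitchPattern

variable {Ω : Type*} [Fintype Ω] [DecidableEq Ω] {r d K : ℕ} (S : SwitchPattern Ω r d K)

/-- The number of permutations of weight `k`. -/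
def count (k : ℕ) : ℕ := ∑ c, if S.weight c = k then 1 else 0

/-- The number of permutations of weight `k - 2`. -/
def countPred (k : ℕ) : ℕ := ∑ c, if S.weight c + 2 = k then 1 else 0

/-- The degrees that have to vanish for a switching to create nothing but the intended
structure. -/
def err (c : Equiv.Perm Ω) (u x : Ω) : ℕ :=
  S.deg c u + S.deg c x + S.deg (c * Equiv.swap u x) x

/-- If the error degrees and the excess `e` all vanish, the weight rises by exactly 2 and the
indicators agree. Otherwise the error term is at least 1 and pays for any discrepancy. -/
lemma indicator_switch (c : Equiv.Perm Ω) (u x : Ω) (k e : ℕ)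
    (h : S.deg (c * Equiv.swap u x) u = 2 + e) :
    (if S.weight (c * Equiv.swap u x) = k then 1 else 0) ≤
        (if S.weight c + 2 = k then 1 else 0) + (S.err c u x + e) ∧
      (if S.weight c + 2 = k then 1 else 0) ≤
        (if S.weight (c * Equiv.swap u x) = k then 1 else 0) + (S.err c u x + e) := by
  by_cases h0 : S.err c u x + e = 0
  · unfold err at h0
    have := S.weight_switch c u x (by omega) (by omega)
    have hw : S.weight (c * Equiv.swap u x) = S.weight c + 2 := by omega
    simp [hw]
  · constructor <;> split_ifs <;> omega

/-- A forbidden arc lies in no forbidden pair, so the new arc at `u` has degree exactly 2 and there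
is no excess. -/
lemma loop_indicator_switch (c : Equiv.Perm Ω) (u x : Ω) (k : ℕ) :
    S.L u (c x) * (if S.weight (c * Equiv.swap u x) = k then 1 else 0) ≤
        S.L u (c x) * (if S.weight c + 2 = k then 1 else 0) + S.L u (c x) * S.err c u x ∧
      S.L u (c x) * (if S.weight c + 2 = k then 1 else 0) ≤
        S.L u (c x) * (if S.weight (c * Equiv.swap u x) = k then 1 else 0) +
          S.L u (c x) * S.err c u x := by
  rcases Nat.eq_zero_or_pos (S.L u (c x)) with h0 | h0
  · simp [h0]
  have h1 : S.L u (c x) = 1 := le_antisymm (S.L_le _ _) h0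
  have hm : S.nbr (c * Equiv.swap u x) u = 0 := by
    refine Finset.sum_eq_zero fun w _ => ?_
    have := S.R_mul_L u ((c * Equiv.swap u x) u) w ((c * Equiv.swap u x) w)
    rw [Nat.mul_eq_zero] at this
    rcases this with h | h
    · exact h
    · simp [h1] at h
  have := S.indicator_switch c u x k 0 (by simp [deg, hm, h1])
  simpa [h1] using this

/-- By `R_mul_L` the new arc at `w` is not itself forbidden. It has the partner at `u`, and every
further partner adds 2 to the excess. -/
lemma pair_indicator_switch (c : Equiv.Perm Ω) (u w x : Ω) (k : ℕ) :
    S.R u (c u) w (c x) * (if S.weight (c * Equiv.swap w x) = k then 1 else 0) ≤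
        S.R u (c u) w (c x) * (if S.weight c + 2 = k then 1 else 0) +
          S.R u (c u) w (c x) * (S.err c w x + 2 * (S.nbr (c * Equiv.swap w x) w - 1)) ∧
      S.R u (c u) w (c x) * (if S.weight c + 2 = k then 1 else 0) ≤
        S.R u (c u) w (c x) * (if S.weight (c * Equiv.swap w x) = k then 1 else 0) +
          S.R u (c u) w (c x) * (S.err c w x + 2 * (S.nbr (c * Equiv.swap w x) w - 1)) := by
  rcases Nat.eq_zero_or_pos (S.R u (c u) w (c x)) with h0 | h0
  · simp [h0]
  have h1 : S.R u (c u) w (c x) = 1 := le_antisymm (S.R_le _ _ _ _) h0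
  have huw : u ≠ w := by
    rintro rfl
    simp [S.R_tail] at h1
  have hux : u ≠ x := by
    rintro rfl
    simp [S.R_head] at h1
  have hL : S.L w ((c * Equiv.swap w x) w) = 0 := by
    have := S.R_mul_L w (c x) u (c u)
    rw [S.R_symm, h1, one_mul] at this
    simpa using this
  have hm : 1 ≤ S.nbr (c * Equiv.swap w x) w := by
    refine le_trans ?_ (S.R_le_nbr _ w u)
    rw [S.R_symm]
    simp [Equiv.swap_apply_of_ne_of_ne huw hux, h1]
  have := S.indicator_switch c w x k (2 * (S.nbr (c * Equiv.swap w x) w - 1))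
    (by unfold deg; omega)
  simpa [h1] using this

/-- Degrees before the switching are summed directly through the row and column sums of `L`. The
degree after it is treated by undoing the switching, which yields loops times total degree and hence
the second moment. -/
lemma sum_loop_err_le :
    ∑ c : Equiv.Perm Ω, ∑ u, ∑ x, S.L u (c x) * S.err c u x ≤
      4 * r * ∑ c, S.weight c + 2 * ∑ c, S.weight c * S.weight c := by
  have e := S.sum_loop_switch (fun c x => S.deg c x)
  have h1 : ∑ c, r * ∑ u, S.deg c u ≤ 2 * r * ∑ c, S.weight c := by
    rw [Finset.mul_sum]
    refine Finset.sum_le_sum fun c _ => ?_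
    linarith [Nat.mul_le_mul_left r (S.sum_deg_le c)]
  have h2 : ∑ c, S.loops c * ∑ x, S.deg c x ≤ 2 * ∑ c, S.weight c * S.weight c := by
    rw [Finset.mul_sum]
    refine Finset.sum_le_sum fun c _ => ?_
    have h : S.loops c ≤ S.weight c := by unfold weight; omega
    linarith [Nat.mul_le_mul h (S.sum_deg_le c)]
  simp only [err, mul_add, Finset.sum_add_distrib, e, S.sum_loop_row, S.sum_loop_col]
  linarith

lemma nbr_mul_pred (c : Equiv.Perm Ω) (w : Ω) :
    S.nbr c w * (S.nbr c w - 1) =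
      ∑ u, ∑ v ∈ {u}ᶜ, S.R w (c w) u (c u) * S.R w (c w) v (c v) := by
  have h : ∀ u, ∑ v ∈ {u}ᶜ, S.R w (c w) u (c u) * S.R w (c w) v (c v) =
      S.R w (c w) u (c u) * (S.nbr c w - 1) := by
    intro u
    rw [← Finset.mul_sum]
    rcases Nat.eq_zero_or_pos (S.R w (c w) u (c u)) with h0 | h0
    · simp [h0]
    · have h1 := S.R_le w (c w) u (c u)
      have h2 := Finset.sum_add_sum_compl {u} (fun v => S.R w (c w) v (c v))
      rw [Finset.sum_singleton] at h2
      congr 1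
      unfold nbr
      omega
  simp only [h, ← Finset.sum_mul]
  rfl

/-- Forbidden pairs rarely share an arc. -/
lemma sum_nbr_mul_pred_le :
    (Fintype.card Ω - 2) * ∑ c : Equiv.Perm Ω, ∑ w, S.nbr c w * (S.nbr c w - 1) ≤
      d * ∑ c, S.pairs c := by
  have h1 : ∀ w u v, (Fintype.card Ω - 2) *
      ∑ c : Equiv.Perm Ω, S.R w (c w) u (c u) * S.R w (c w) v (c v) * (if v = u then 0 else 1) ≤
      ∑ c : Equiv.Perm Ω, ∑ x, S.R w (c w) u (c u) * S.R w (c w) v (c x) := by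
    intro w u v
    rcases eq_or_ne v w with rfl | hvw
    · simp [S.R_tail]
    rcases eq_or_ne v u with rfl | hvu
    · simp
    simp only [hvu, if_false, mul_one]
    -- For `x` outside `{w, u}` the switching at `v` and `x` keeps the arcs at `w` and `u` and gives
    -- `v` the head `c x`. There are at least N - 2 such `x`.
    have hc : Fintype.card Ω - 2 ≤ (({w, u} : Finset Ω)ᶜ).card := by
      rw [Finset.card_compl]
      have := Finset.card_le_two (a := w) (b := u)
      omega
    refine (Nat.mul_le_mul_right _ hc).trans ?_
    rw [← smul_eq_mul, ← Finset.sum_const, Finset.sum_comm (t := Finset.univ (α := Ω))]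
    refine le_trans (Finset.sum_le_sum fun x hx => ?_)
      (Finset.sum_le_sum_of_subset (Finset.subset_univ ({w, u}ᶜ : Finset Ω)))
    simp only [Finset.mem_compl, Finset.mem_insert, Finset.mem_singleton, not_or] at hx
    rw [← sum_switch v x (fun c => S.R w (c w) u (c u) * S.R w (c w) v (c v))]
    simp [Equiv.swap_apply_of_ne_of_ne hvw.symm (Ne.symm hx.1),
      Equiv.swap_apply_of_ne_of_ne hvu.symm (Ne.symm hx.2)]
  have h2 : ∀ c : Equiv.Perm Ω, ∑ w, S.nbr c w * (S.nbr c w - 1) = ∑ w, ∑ u, ∑ v,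
      S.R w (c w) u (c u) * S.R w (c w) v (c v) * (if v = u then 0 else 1) := by
    intro c
    simp only [S.nbr_mul_pred]
    refine Finset.sum_congr rfl fun w _ => Finset.sum_congr rfl fun u _ => ?_
    rw [← Finset.sum_add_sum_compl {u} (fun v =>
      S.R w (c w) u (c u) * S.R w (c w) v (c v) * (if v = u then 0 else 1))]
    simp only [Finset.sum_singleton, if_true, mul_zero, zero_add]
    refine Finset.sum_congr rfl fun v hv => ?_
    rw [Finset.mem_compl, Finset.mem_singleton] at hv
    simp [hv]
  have hcomm : ∀ f : Equiv.Perm Ω → Ω → Ω → Ω → ℕ,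
      ∑ c, ∑ w, ∑ u, ∑ v, f c w u v = ∑ w, ∑ u, ∑ v, ∑ c, f c w u v := by
    intro f
    rw [Finset.sum_comm]
    refine Finset.sum_congr rfl fun w _ => ?_
    rw [Finset.sum_comm]
    refine Finset.sum_congr rfl fun u _ => ?_
    rw [Finset.sum_comm]
  calc (Fintype.card Ω - 2) * ∑ c : Equiv.Perm Ω, ∑ w, S.nbr c w * (S.nbr c w - 1)
      ≤ ∑ w, ∑ u, ∑ v, ∑ c : Equiv.Perm Ω, ∑ x,
          S.R w (c w) u (c u) * S.R w (c w) v (c x) := by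
        simp only [h2]
        rw [hcomm]
        simp only [Finset.mul_sum]
        refine Finset.sum_le_sum fun w _ => Finset.sum_le_sum fun u _ =>
          Finset.sum_le_sum fun v _ => ?_
        rw [← Finset.mul_sum]
        exact h1 w u v
    _ = ∑ c : Equiv.Perm Ω, ∑ w, ∑ u, ∑ v, ∑ x,
          S.R w (c w) u (c u) * S.R w (c w) v (c x) := (hcomm _).symm
    _ ≤ ∑ c : Equiv.Perm Ω, ∑ w, ∑ u, S.R w (c w) u (c u) * d := by
        gcongr with c _ w _ u _
        simp only [← Finset.mul_sum]
        gcongr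
        rw [S.R_row_perm]
        exact S.R_row_le _ _
    _ = d * ∑ c, S.pairs c := by
        simp only [← Finset.sum_mul, pairs, nbr]
        ring

/-- Degrees at `w` and `x` before the switching are handled by `R_out` and `R_in`, the degree at `x`
after it by undoing the switching, and the excess by the rarity of pairs sharing an arc. -/
lemma sum_pair_err_le (hN : 3 ≤ Fintype.card Ω) :
    ∑ c : Equiv.Perm Ω, ∑ u, ∑ w, ∑ x, S.R u (c u) w (c x) *
        (S.err c w x + 2 * (S.nbr (c * Equiv.swap w x) w - 1)) ≤
      (4 * K + 4 * d) * ∑ c, S.weight c + 2 * ∑ c, S.weight c * S.weight c := by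
  have e1 : ∑ c : Equiv.Perm Ω, ∑ u, ∑ w, ∑ x, S.R u (c u) w (c x) *
      S.deg (c * Equiv.swap w x) x ≤ 2 * ∑ c, S.weight c * S.weight c := by
    rw [S.sum_pair_switch (fun c _ x => S.deg c x), Finset.mul_sum]
    refine Finset.sum_le_sum fun c _ => ?_
    calc ∑ u, ∑ w, ∑ x ∈ {u}ᶜ, S.R u (c u) w (c w) * S.deg c x
        ≤ ∑ u, ∑ w, ∑ x, S.R u (c u) w (c w) * S.deg c x := by
          gcongr
          exact Finset.subset_univ _
      _ = S.pairs c * ∑ x, S.deg c x := by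
          simp only [← Finset.mul_sum, ← Finset.sum_mul, pairs, nbr]
      _ ≤ S.weight c * (2 * S.weight c) :=
          Nat.mul_le_mul (by unfold weight; omega) (S.sum_deg_le c)
      _ = _ := by ring
  have e2 : ∑ c : Equiv.Perm Ω, ∑ u, ∑ w, ∑ x, S.R u (c u) w (c x) *
      (S.nbr (c * Equiv.swap w x) w - 1) ≤ 2 * (d * ∑ c, S.weight c) := by
    rw [S.sum_pair_switch (fun c w _ => S.nbr c w - 1)]
    calc ∑ c : Equiv.Perm Ω, ∑ u, ∑ w, ∑ x ∈ {u}ᶜ, S.R u (c u) w (c w) * (S.nbr c w - 1)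
        = (Fintype.card Ω - 1) * ∑ c : Equiv.Perm Ω, ∑ w, S.nbr c w * (S.nbr c w - 1) := by
          simp only [Finset.sum_const, smul_eq_mul, Finset.card_compl, Finset.card_singleton,
            ← Finset.mul_sum]
          congr 1
          refine Finset.sum_congr rfl fun c _ => ?_
          rw [Finset.sum_comm]
          refine Finset.sum_congr rfl fun w _ => ?_
          rw [← Finset.sum_mul]
          congr 1
          exact Finset.sum_congr rfl fun u _ => S.R_symm _ _ _ _
      _ ≤ (2 * (Fintype.card Ω - 2)) *
            ∑ c : Equiv.Perm Ω, ∑ w, S.nbr c w * (S.nbr c w - 1) := by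
          gcongr
          omega
      _ ≤ 2 * (d * ∑ c, S.weight c) := by
          rw [mul_assoc]
          refine Nat.mul_le_mul_left 2 (S.sum_nbr_mul_pred_le.trans ?_)
          gcongr with c _
          unfold weight
          omega
  have e3 : ∑ c : Equiv.Perm Ω, ∑ u, ∑ w, ∑ x, S.R u (c u) w (c x) * S.deg c w ≤
      2 * K * ∑ c, S.weight c := by
    rw [Finset.mul_sum]
    refine Finset.sum_le_sum fun c _ => (S.sum_pair_out_le c _).trans ?_
    have := Nat.mul_le_mul_left K (S.sum_deg_le c)
    linarith
  have e4 : ∑ c : Equiv.Perm Ω, ∑ u, ∑ w, ∑ x, S.R u (c u) w (c x) * S.deg c x ≤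
      2 * K * ∑ c, S.weight c := by
    rw [Finset.mul_sum]
    refine Finset.sum_le_sum fun c _ => (S.sum_pair_in_le c _).trans ?_
    have := Nat.mul_le_mul_left K (S.sum_deg_le c)
    linarith
  simp only [err, mul_add, Finset.sum_add_distrib, mul_left_comm _ 2, ← Finset.mul_sum]
  linarith

lemma loops_count (k : ℕ) :
    |(Fintype.card Ω : ℝ) * (∑ c, S.loops c * (if S.weight c = k then 1 else 0) : ℕ) -
        Fintype.card Ω * (r * S.countPred k)| ≤
      (4 * r * ∑ c, S.weight c + 2 * ∑ c, S.weight c * S.weight c : ℕ) := by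
  have e1 := S.sum_loop_switch (fun c _ => if S.weight c = k then 1 else 0)
  have e1' : ∑ c : Equiv.Perm Ω, S.loops c * ∑ _x : Ω, (if S.weight c = k then 1 else 0) =
      Fintype.card Ω * ∑ c, S.loops c * (if S.weight c = k then 1 else 0) := by
    rw [Finset.mul_sum]
    refine Finset.sum_congr rfl fun c _ => ?_
    simp only [Finset.sum_const, smul_eq_mul, Finset.card_univ]
    ring
  rw [e1'] at e1
  have e2 : ∑ c : Equiv.Perm Ω, ∑ u, ∑ x, S.L u (c x) * (if S.weight c + 2 = k then 1 else 0) =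
      Fintype.card Ω * (r * S.countPred k) := by
    simp only [S.sum_loop_const, ← Finset.mul_sum, countPred]
    ring
  have h1 := Finset.sum_le_sum fun c (_ : c ∈ Finset.univ) => Finset.sum_le_sum
    fun u (_ : u ∈ Finset.univ) => Finset.sum_le_sum fun x (_ : x ∈ Finset.univ) =>
      (S.loop_indicator_switch c u x k).1
  have h2 := Finset.sum_le_sum fun c (_ : c ∈ Finset.univ) => Finset.sum_le_sum
    fun u (_ : u ∈ Finset.univ) => Finset.sum_le_sum fun x (_ : x ∈ Finset.univ) =>
      (S.loop_indicator_switch c u x k).2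
  simp only [Finset.sum_add_distrib, e1, e2] at h1 h2
  have h3 := S.sum_loop_err_le
  rw [abs_le]
  constructor
  · have := h2.trans (Nat.add_le_add_left h3 _)
    have := (Nat.cast_le (α := ℝ)).2 this
    push_cast at this ⊢
    linarith
  · have := h1.trans (Nat.add_le_add_left h3 _)
    have := (Nat.cast_le (α := ℝ)).2 this
    push_cast at this ⊢
    linarith

/-- Unlike for loops, the main term has a deficit: a forbidden arc at `u` admits no partner. This
loses `d` per such arc, hence `5 * d` in place of `4 * d`. -/
lemma pairs_count (hN : 3 ≤ Fintype.card Ω) (k : ℕ) :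
    |((Fintype.card Ω - 1 : ℕ) : ℝ) * (∑ c, S.pairs c * (if S.weight c = k then 1 else 0) : ℕ) -
        Fintype.card Ω * (d * S.countPred k)| ≤
      ((4 * K + 5 * d) * ∑ c, S.weight c + 2 * ∑ c, S.weight c * S.weight c : ℕ) := by
  have e1 := S.sum_pair_switch' (fun c => if S.weight c = k then 1 else 0)
  have e2 : ∑ c : Equiv.Perm Ω, ∑ u, ∑ w, ∑ x,
      S.R u (c u) w (c x) * (if S.weight c + 2 = k then 1 else 0) +
      d * ∑ c, S.loops c * (if S.weight c + 2 = k then 1 else 0) =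
      Fintype.card Ω * (d * S.countPred k) := by
    rw [Finset.mul_sum, ← Finset.sum_add_distrib]
    simp only [S.sum_pair_const, ← Finset.mul_sum, countPred]
    ring
  have e3 : ∑ c, S.loops c * (if S.weight c + 2 = k then 1 else 0) ≤ ∑ c, S.weight c := by
    refine Finset.sum_le_sum fun c _ => ?_
    unfold weight
    split_ifs <;> omega
  have h1 := Finset.sum_le_sum fun c (_ : c ∈ Finset.univ) => Finset.sum_le_sum
    fun u (_ : u ∈ Finset.univ) => Finset.sum_le_sum fun w (_ : w ∈ Finset.univ) =>
      Finset.sum_le_sum fun x (_ : x ∈ Finset.univ) => (S.pair_indicator_switch c u w x k).1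
  have h2 := Finset.sum_le_sum fun c (_ : c ∈ Finset.univ) => Finset.sum_le_sum
    fun u (_ : u ∈ Finset.univ) => Finset.sum_le_sum fun w (_ : w ∈ Finset.univ) =>
      Finset.sum_le_sum fun x (_ : x ∈ Finset.univ) => (S.pair_indicator_switch c u w x k).2
  simp only [Finset.sum_add_distrib, e1] at h1 h2
  have h3 := S.sum_pair_err_le hN
  have e4 := Nat.mul_le_mul_left d e3
  rw [abs_le]
  have e2' := congrArg (Nat.cast (R := ℝ)) e2
  have e4' := (Nat.cast_le (α := ℝ)).2 e4
  have := (Nat.cast_le (α := ℝ)).2 (h2.trans (Nat.add_le_add_left h3 _))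
  have := (Nat.cast_le (α := ℝ)).2 (h1.trans (Nat.add_le_add_left h3 _))
  have h0 : (0 : ℝ) ≤ ((d * ∑ c, S.loops c * (if S.weight c + 2 = k then 1 else 0) : ℕ) : ℝ) :=
    Nat.cast_nonneg _
  have h5 : (0 : ℝ) ≤ ((d * ∑ c, S.weight c : ℕ) : ℝ) := Nat.cast_nonneg _
  push_cast at *
  constructor <;> linarith

lemma mul_count (k : ℕ) :
    k * S.count k = 2 * ∑ c, S.loops c * (if S.weight c = k then 1 else 0) +
      ∑ c, S.pairs c * (if S.weight c = k then 1 else 0) := by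
  rw [count, Finset.mul_sum, Finset.mul_sum, ← Finset.sum_add_distrib]
  refine Finset.sum_congr rfl fun c _ => ?_
  split_ifs with h
  · rw [← h, weight]; ring
  · simp

/-- The proportion of permutations of weight `k`. -/
noncomputable def prob (k : ℕ) : ℝ := S.count k / (Fintype.card Ω).factorial

/-- The proportion of permutations of weight `k - 2`. -/
noncomputable def probPred (k : ℕ) : ℝ := S.countPred k / (Fintype.card Ω).factorial

lemma countPred_le (k : ℕ) : S.countPred k ≤ (Fintype.card Ω).factorial := by
  calc S.countPred k ≤ ∑ _c : Equiv.Perm Ω, 1 :=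
        Finset.sum_le_sum fun c _ => by split_ifs <;> simp
    _ = _ := by simp [Fintype.card_perm]

/-- The ratio of the probabilities of consecutive weights is asymptotically Poissonian. -/
theorem abs_mul_prob_sub_le (r d K : ℕ) : ∃ C : ℝ, ∀ {Ω : Type} [Fintype Ω] [DecidableEq Ω]
    (S : SwitchPattern Ω r d K), 3 ≤ Fintype.card Ω → ∀ k : ℕ,
      |k * S.prob k - (2 * r + d) * S.probPred k| ≤ C / Fintype.card Ω := by
  -- `A` and `B` bound the mean of W and of W²; `C₁` and `C₂` are the resulting errors for loops and
  -- for pairs.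
  let A : ℝ := 2 * r + 2 * d
  let B : ℝ := A * (2 * r + 6 * d + 4)
  let C₁ : ℝ := 4 * r * A + 2 * B
  let C₂ : ℝ := (4 * K + 5 * d) * A + 2 * B
  refine ⟨2 * C₁ + 2 * (C₂ + d), fun {Ω} _ _ S hN k => ?_⟩
  have hW := (Nat.cast_le (α := ℝ)).2 (S.sum_weight_le (by omega))
  have hW2 := (Nat.cast_le (α := ℝ)).2 (S.sum_weight_sq_le (by omega))
  have h1 := S.loops_count k
  have h2 := S.pairs_count hN k
  have h3 := congrArg (Nat.cast (R := ℝ)) (S.mul_count k)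
  have h4 := (Nat.cast_le (α := ℝ)).2 (S.countPred_le k)
  have hp : (0 : ℝ) ≤ S.countPred k := Nat.cast_nonneg _
  unfold prob probPred
  rw [Nat.cast_add, Nat.cast_mul, Nat.cast_mul] at h3
  rw [Nat.cast_add, Nat.cast_mul, Nat.cast_mul 2] at h1 h2
  rw [Nat.cast_sub (by omega)] at h2
  generalize ((∑ c, S.weight c : ℕ) : ℝ) = w at *
  generalize ((∑ c, S.weight c * S.weight c : ℕ) : ℝ) = w₂ at *
  generalize ((∑ c, S.loops c * (if S.weight c = k then 1 else 0) : ℕ) : ℝ) = a at *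
  generalize ((∑ c, S.pairs c * (if S.weight c = k then 1 else 0) : ℕ) : ℝ) = b at *
  have hf : (0 : ℝ) < (Fintype.card Ω).factorial := by positivity
  have hN' : (3 : ℝ) ≤ Fintype.card Ω := by exact_mod_cast hN
  generalize (S.count k : ℝ) = p at *
  generalize (S.countPred k : ℝ) = q at *
  push_cast at h1 h2 hW hW2 h3 h4
  generalize ((Fintype.card Ω).factorial : ℝ) = f at *
  generalize (Fintype.card Ω : ℝ) = N at *
  have hNpos : 0 < N := by linarith
  have hr : (0 : ℝ) ≤ r := Nat.cast_nonneg _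
  have hd : (0 : ℝ) ≤ d := Nat.cast_nonneg _
  have hK : (0 : ℝ) ≤ K := Nat.cast_nonneg _
  have g1 : N * |a - r * q| ≤ C₁ * f := by
    rw [← mul_sub, abs_mul, abs_of_pos hNpos] at h1
    refine h1.trans ?_
    have := mul_le_mul_of_nonneg_left hW (by positivity : (0 : ℝ) ≤ 4 * r)
    simp only [C₁, B, A]
    linarith
  -- Replacing the factor N of the main term by N - 1 costs a further `d * q`, at most `d * f`.
  have g2 : (N - 1) * |b - d * q| ≤ (C₂ + d) * f := by
    have : (N - 1) * (b - d * q) = ((N - 1) * b - N * (d * q)) + d * q := by ring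
    rw [← abs_of_nonneg (by linarith : 0 ≤ N - 1), ← abs_mul, this]
    refine (abs_add_le _ _).trans ?_
    rw [abs_of_nonneg (mul_nonneg hd hp)]
    have h5 := mul_le_mul_of_nonneg_left h4 hd
    have h6 := mul_le_mul_of_nonneg_left hW (by positivity : (0 : ℝ) ≤ 4 * K + 5 * d)
    simp only [C₂, B, A]
    linarith
  have g3 : N * |b - d * q| ≤ 2 * ((C₂ + d) * f) := by
    have : N * |b - d * q| ≤ (2 * (N - 1)) * |b - d * q| :=
      mul_le_mul_of_nonneg_right (by linarith) (abs_nonneg _)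
    linarith
  have e : k * (p / f) - (2 * r + d) * (q / f) = (2 * (a - r * q) + (b - d * q)) / f := by
    rw [← mul_div_assoc, h3]
    ring
  rw [e, abs_div, abs_of_pos hf, div_le_div_iff₀ hf hNpos]
  have g4 : |2 * (a - r * q) + (b - d * q)| ≤ 2 * |a - r * q| + |b - d * q| := by
    refine (abs_add_le _ _).trans ?_
    rw [abs_mul, abs_two]
  have := mul_le_mul_of_nonneg_right g4 hNpos.le
  linarith

end SwitchPattern

/-! ### From the recursion to the mass at zero -/

/-- A weight distribution with bounded means whose consecutive ratios are asymptotically those of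
twice a Poisson variable with mean `lam / 2` has a mass at `0` tending to `exp (-lam / 2)`. -/
theorem tendsto_zero_mass {p : ℕ → ℕ → ℝ} {lam B : ℝ} (hp : ∀ n k, 0 ≤ p n k)
    (hsum : ∀ M, ∀ᶠ n in atTop, ∑ k ∈ Finset.range M, p n k ≤ 1)
    (htail : ∀ M, ∀ᶠ n in atTop, M * (1 - ∑ k ∈ Finset.range M, p n k) ≤ B)
    (hone : Tendsto (fun n => p n 1) atTop (𝓝 0))
    (hrec : ∀ k : ℕ, Tendsto (fun n => ((k + 2 : ℕ) : ℝ) * p n (k + 2) - lam * p n k)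
      atTop (𝓝 0)) :
    Tendsto (fun n => p n 0) atTop (𝓝 (Real.exp (-(lam / 2)))) := by
  -- Convergence of `p n 0` is not yet known, so each mass is compared with a multiple of `p n 0` at
  -- the same `n`.
  have hstep : ∀ k : ℕ, ∀ a : ℝ, Tendsto (fun n => p n k - a * p n 0) atTop (𝓝 0) →
      Tendsto (fun n => p n (k + 2) - lam * a / (k + 2 : ℕ) * p n 0) atTop (𝓝 0) := by
    intro k a h
    have h2 := ((hrec k).add (h.const_mul lam)).const_mul (((k + 2 : ℕ) : ℝ)⁻¹)
    simp only [mul_zero, add_zero] at h2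
    refine h2.congr fun n => ?_
    have : ((k + 2 : ℕ) : ℝ) ≠ 0 := by positivity
    field_simp
    ring
  have hodd : ∀ m : ℕ, Tendsto (fun n => p n (2 * m + 1)) atTop (𝓝 0) := by
    intro m
    induction m with
    | zero => simpa using hone
    | succ m ih => simpa [mul_add, add_right_comm] using hstep (2 * m + 1) 0 (by simpa using ih)
  have heven : ∀ m : ℕ, Tendsto (fun n => p n (2 * m) - (lam / 2) ^ m / m.factorial * p n 0)
      atTop (𝓝 0) := by
    intro m
    induction m with
    | zero => simp
    | succ m ih =>
      have := hstep (2 * m) _ ih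
      refine this.congr fun n => ?_
      have : (m.factorial : ℝ) ≠ 0 := by positivity
      rw [show 2 * (m + 1) = 2 * m + 2 by ring, Nat.factorial_succ, pow_succ]
      push_cast
      field_simp
  have hpartial : ∀ M : ℕ, Tendsto (fun n => ∑ k ∈ Finset.range (2 * M), p n k -
      (∑ m ∈ Finset.range M, (lam / 2) ^ m / m.factorial) * p n 0) atTop (𝓝 0) := by
    intro M
    induction M with
    | zero => simp
    | succ M ih =>
      have := (ih.add (heven M)).add (hodd M)
      simp only [add_zero] at this
      refine this.congr fun n => ?_
      rw [show 2 * (M + 1) = 2 * M + 1 + 1 by ring, Finset.sum_range_succ, Finset.sum_range_succ,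
        Finset.sum_range_succ]
      ring
  have hexp : Tendsto (fun M : ℕ => ∑ m ∈ Finset.range M, (lam / 2) ^ m / m.factorial) atTop
      (𝓝 (Real.exp (lam / 2))) := by
    rw [Real.exp_eq_exp_ℝ]
    exact (NormedSpace.expSeries_div_hasSum_exp (lam / 2)).tendsto_sum_nat
  have hmain : Tendsto (fun n => Real.exp (lam / 2) * p n 0) atTop (𝓝 1) := by
    rw [Metric.tendsto_atTop']
    intro ε hε
    have hB : Tendsto (fun M : ℕ => |B| / ((2 * M : ℕ) : ℝ)) atTop (𝓝 0) := by
      refine tendsto_const_nhds.div_atTop ?_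
      exact tendsto_natCast_atTop_atTop.comp
        (tendsto_id.const_mul_atTop' (by norm_num : 0 < 2))
    have hε4 : 0 < ε / 4 := by linarith
    -- `M` is fixed first, making the exponential remainder and the Markov tail `|B| / (2M)` small;
    -- only then does `n` grow.
    obtain ⟨M, hM1, hM2, hM3⟩ := (((Metric.tendsto_nhds.1 hexp) _ hε4).and
      (((Metric.tendsto_nhds.1 hB) _ hε4).and (eventually_ge_atTop 1))).exists
    have hev : ∀ᶠ n in atTop, dist (Real.exp (lam / 2) * p n 0) 1 < ε := by
      filter_upwards [hsum 1, hsum (2 * M), htail (2 * M),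
        (Metric.tendsto_nhds.1 (hpartial M)) _ hε4] with n h0 h1 h2 h3
      simp only [Finset.sum_range_one] at h0
      rw [Real.dist_eq] at hM1 hM2 h3 ⊢
      rw [sub_zero] at hM2 h3
      have hMpos : (0 : ℝ) < ((2 * M : ℕ) : ℝ) := by
        exact_mod_cast (by omega : 0 < 2 * M)
      have h4 : 1 - ∑ k ∈ Finset.range (2 * M), p n k ≤ |B| / ((2 * M : ℕ) : ℝ) := by
        rw [le_div_iff₀ hMpos]
        have := le_abs_self B
        linarith
      rw [abs_lt] at hM1 hM2 h3
      have h5 := hp n 0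
      have h6 : |(∑ m ∈ Finset.range M, (lam / 2) ^ m / m.factorial - Real.exp (lam / 2)) *
          p n 0| ≤ ε / 4 := by
        rw [abs_mul, abs_of_nonneg h5]
        have := (abs_lt.2 hM1).le
        calc _ ≤ ε / 4 * 1 := by gcongr
          _ = _ := mul_one _
      rw [abs_le] at h6
      rw [abs_lt]
      constructor <;> nlinarith
    obtain ⟨n₀, hn₀⟩ := eventually_atTop.1 hev
    exact ⟨n₀, fun n hn => hn₀ n hn.le⟩
  have := hmain.const_mul (Real.exp (-(lam / 2)))
  rw [mul_one] at this
  refine this.congr fun n => ?_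
  rw [← mul_assoc, ← Real.exp_add]
  simp

/-! ### The Poisson limit for switch patterns -/

namespace SwitchPattern

variable {Ω : Type*} [Fintype Ω] [DecidableEq Ω] {r d K : ℕ} (S : SwitchPattern Ω r d K)

lemma probPred_add_two (k : ℕ) : S.probPred (k + 2) = S.prob k := by
  simp [probPred, prob, countPred, count]

/-- This starts the odd masses: the recursion at weight 1 gives `prob 1` tending to 0. -/
lemma probPred_one : S.probPred 1 = 0 := by
  simp [probPred, countPred]

lemma sum_range_count (M : ℕ) :
    ∑ k ∈ Finset.range M, S.count k = ∑ c, if S.weight c < M then 1 else 0 := by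
  simp only [count]
  rw [Finset.sum_comm]
  exact Finset.sum_congr rfl fun c _ => by simp

lemma sum_range_prob_le (M : ℕ) : ∑ k ∈ Finset.range M, S.prob k ≤ 1 := by
  simp only [prob]
  rw [← Finset.sum_div, div_le_one (by positivity), ← Nat.cast_sum, S.sum_range_count]
  refine Nat.cast_le.2 ?_
  calc _ ≤ ∑ _c : Equiv.Perm Ω, 1 := Finset.sum_le_sum fun c _ => by split_ifs <;> simp
    _ = _ := by simp [Fintype.card_perm]

/-- Markov's inequality for the weight. -/
lemma mul_tail_prob_le (hN : 2 ≤ Fintype.card Ω) (M : ℕ) :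
    M * (1 - ∑ k ∈ Finset.range M, S.prob k) ≤ 2 * r + 2 * d := by
  have hf : (0 : ℝ) < (Fintype.card Ω).factorial := by positivity
  have h : M * (Fintype.card Ω).factorial ≤
      M * ∑ k ∈ Finset.range M, S.count k + ∑ c, S.weight c := by
    rw [S.sum_range_count, Finset.mul_sum, ← Finset.sum_add_distrib]
    calc _ = ∑ _c : Equiv.Perm Ω, M := by simp [Fintype.card_perm, mul_comm]
      _ ≤ _ := Finset.sum_le_sum fun c _ => by split_ifs <;> omega
  have h' := (Nat.cast_le (α := ℝ)).2 (h.trans (Nat.add_le_add_left (S.sum_weight_le hN) _))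
  simp only [prob]
  rw [← Finset.sum_div, ← mul_le_mul_iff_of_pos_right hf]
  push_cast at h'
  field_simp
  linarith

/-- If patterns with fixed parameters live on ground sets of growing size, then the probability
that a random permutation avoids the pattern tends to the Poisson value. -/
theorem tendsto_prob_zero {r d K : ℕ} {Ω : ℕ → Type} [∀ n, Fintype (Ω n)]
    [∀ n, DecidableEq (Ω n)] (S : ∀ n, SwitchPattern (Ω n) r d K)
    (hcard : Tendsto (fun n => Fintype.card (Ω n)) atTop atTop) :
    Tendsto (fun n => (S n).prob 0) atTop (𝓝 (Real.exp (-((2 * r + d) / 2)))) := by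
  obtain ⟨C, hC⟩ := abs_mul_prob_sub_le r d K
  have hlim : ∀ k : ℕ, Tendsto (fun n => (k : ℝ) * (S n).prob k -
      (2 * r + d) * (S n).probPred k) atTop (𝓝 0) := by
    intro k
    have h0 : Tendsto (fun n => C / Fintype.card (Ω n)) atTop (𝓝 0) :=
      tendsto_const_nhds.div_atTop (tendsto_natCast_atTop_atTop.comp hcard)
    refine squeeze_zero_norm' ?_ h0
    filter_upwards [hcard.eventually_ge_atTop 3] with n hn
    exact hC (S n) hn k
  refine tendsto_zero_mass (p := fun n k => (S n).prob k) (B := 2 * r + 2 * d)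
    (fun n k => div_nonneg (Nat.cast_nonneg _) (Nat.cast_nonneg _))
    (fun M => Eventually.of_forall fun n => (S n).sum_range_prob_le M) (fun M => ?_) ?_
    (fun k => ?_)
  · filter_upwards [hcard.eventually_ge_atTop 2] with n hn
    exact (S n).mul_tail_prob_le hn M
  · simpa [probPred_one] using hlim 1
  · simpa only [probPred_add_two] using hlim (k + 2)

end SwitchPattern

/-! ### Loops, parallel arcs and digons as a switch pattern -/

namespace DirectedConfiguration

variable {n r : ℕ}

lemma sum_fst_eq (i : Fin n) : ∑ u : Fin n × Fin r, (if u.1 = i then 1 else 0) = r := by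
  rw [Fintype.sum_prod_type_right]
  simp

lemma sum_fst_eq' (i : Fin n) : ∑ u : Fin n × Fin r, (if i = u.1 then 1 else 0) = r := by
  simp only [eq_comm (a := i), sum_fst_eq]

lemma sum_perm_fst_eq (c : Equiv.Perm (Fin n × Fin r)) (i : Fin n) :
    ∑ u, (if (c u).1 = i then 1 else 0) = r :=
  (Equiv.sum_comp c (fun u => if u.1 = i then 1 else 0)).trans (sum_fst_eq i)

lemma sum_perm_fst_eq' (c : Equiv.Perm (Fin n × Fin r)) (i : Fin n) :
    ∑ u, (if i = (c u).1 then 1 else 0) = r := by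
  simp only [eq_comm (a := i), sum_perm_fst_eq]

lemma sum_fst_eq_ne (u : Fin n × Fin r) :
    ∑ u' : Fin n × Fin r, (if u ≠ u' ∧ u.1 = u'.1 then 1 else 0) = r - 1 := by
  have h := sum_fst_eq' (r := r) u.1
  rw [← Finset.sum_add_sum_compl {u}] at h
  simp only [Finset.sum_singleton, if_true] at h
  rw [← Finset.sum_add_sum_compl {u}]
  simp only [Finset.sum_singleton, ne_eq, not_true_eq_false, false_and, if_false, zero_add]
  have e : ∑ u' ∈ {u}ᶜ, (if ¬ u = u' ∧ u.1 = u'.1 then 1 else 0) =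
      ∑ u' ∈ {u}ᶜ, (if u.1 = u'.1 then 1 else 0) := by
    refine Finset.sum_congr rfl fun u' hu' => ?_
    have : u ≠ u' := by
      rintro rfl
      simp at hu'
    simp [this]
  omega

/-- Marks the pairs of distinct non-loop arcs that are parallel or antiparallel. -/
def clash (u v u' v' : Fin n × Fin r) : ℕ :=
  if u.1 ≠ v.1 ∧ u ≠ u' ∧ v ≠ v' ∧
    ((u.1 = u'.1 ∧ v.1 = v'.1) ∨ (u.1 = v'.1 ∧ v.1 = u'.1)) then 1 else 0

lemma clash_le (u v u' v' : Fin n × Fin r) :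
    clash u v u' v' ≤ (if u.1 = u'.1 then 1 else 0) * (if v.1 = v'.1 then 1 else 0) +
      (if u.1 = v'.1 then 1 else 0) * (if v.1 = u'.1 then 1 else 0) := by
  unfold clash
  split_ifs <;> simp_all

/-- For a non-loop arc the parallel and antiparallel cases exclude each other, and an antiparallel
arc automatically uses different points. The products make the choices of tail and head independent.
-/
lemma clash_eq {u v : Fin n × Fin r} (h : u.1 ≠ v.1) (u' v' : Fin n × Fin r) :
    clash u v u' v' =
      (if u ≠ u' ∧ u.1 = u'.1 then 1 else 0) * (if v ≠ v' ∧ v.1 = v'.1 then 1 else 0) +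
      (if v.1 = u'.1 then 1 else 0) * (if u.1 = v'.1 then 1 else 0) := by
  have h1 : u.1 = v'.1 → v ≠ v' := fun h1 h2 => h (h1.trans (congrArg Prod.fst h2).symm)
  have h2 : v.1 = u'.1 → u ≠ u' := fun h1 h2 => h ((congrArg Prod.fst h2).trans h1.symm)
  have h3 : u.1 = u'.1 → ¬ v.1 = u'.1 := fun h1 h2 => h (h1.trans h2.symm)
  unfold clash
  by_cases a : u.1 = u'.1 <;> by_cases b : v.1 = v'.1 <;> by_cases a' : u.1 = v'.1 <;>
    by_cases b' : v.1 = u'.1 <;> by_cases e : u = u' <;> by_cases e' : v = v' <;> simp_all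

/-- Loops, and pairs of parallel or antiparallel arcs. -/
def pattern (n r : ℕ) :
    SwitchPattern (Fin n × Fin r) r ((r - 1) ^ 2 + r ^ 2) (2 * r ^ 2) where
  L u v := if u.1 = v.1 then 1 else 0
  R := clash
  L_le u v := by split_ifs <;> simp
  R_le u v u' v' := by unfold clash; split_ifs <;> simp
  L_row u := sum_fst_eq' u.1
  L_col v := sum_fst_eq v.1
  R_symm u v u' v' := by
    unfold clash
    congr 1
    apply propext
    constructor
    · rintro ⟨h, hu, hv, ⟨a, b⟩ | ⟨a, b⟩⟩
      · exact ⟨a ▸ b ▸ h, hu.symm, hv.symm, Or.inl ⟨a.symm, b.symm⟩⟩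
      · exact ⟨fun e => h (a.trans (e.symm.trans b.symm)), hu.symm, hv.symm,
          Or.inr ⟨b.symm, a.symm⟩⟩
    · rintro ⟨h, hu, hv, ⟨a, b⟩ | ⟨a, b⟩⟩
      · exact ⟨a ▸ b ▸ h, hu.symm, hv.symm, Or.inl ⟨a.symm, b.symm⟩⟩
      · exact ⟨fun e => h (a.trans (e.symm.trans b.symm)), hu.symm, hv.symm,
          Or.inr ⟨b.symm, a.symm⟩⟩
  R_mul_L u v u' v' := by unfold clash; split_ifs <;> simp_all
  R_tail u v v' := by simp [clash]
  R_head u v u' := by simp [clash]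
  -- A non-loop arc has (r-1)² possible parallel partners and r² antiparallel ones.
  R_sum u v := by
    by_cases h : u.1 = v.1
    · simp [clash, h]
    · simp only [clash_eq h, Finset.sum_add_distrib, ← Finset.sum_mul_sum, sum_fst_eq_ne,
        sum_fst_eq', h, if_false]
      ring
  R_out c w := by
    -- In each of the two cases there are `r` choices of `u`, then `r` of `x`.
    refine (Finset.sum_le_sum fun u _ => Finset.sum_le_sum fun x _ => clash_le _ _ _ _).trans ?_
    simp only [Finset.sum_add_distrib, ← Finset.mul_sum, ← Finset.sum_mul, sum_fst_eq,
      sum_perm_fst_eq, sum_perm_fst_eq']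
    exact (by ring : r * r + r * r = 2 * r ^ 2).le
  R_in c x := by
    refine (Finset.sum_le_sum fun u _ => Finset.sum_le_sum fun w _ => clash_le _ _ _ _).trans ?_
    simp only [Finset.sum_add_distrib, ← Finset.mul_sum, ← Finset.sum_mul, sum_fst_eq,
      sum_fst_eq', sum_perm_fst_eq]
    exact (by ring : r * r + r * r = 2 * r ^ 2).le

/-- Once loops are excluded, the side conditions in `clash` are harmless: distinct tails have
distinct heads because `c` is injective, and an arc antiparallel to itself would be a loop. -/
lemma isOrientedGraph_iff (c : DirectedConfiguration n r) :
    c.toMultidigraph.IsOrientedGraph ↔ (pattern n r).weight c = 0 := by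
  have hL : (pattern n r).loops c = 0 ↔ ∀ u, u.1 ≠ (c u).1 := by
    simp [SwitchPattern.loops, pattern]
  have hR : (pattern n r).pairs c = 0 ↔ ∀ u w, clash u (c u) w (c w) = 0 := by
    simp [SwitchPattern.pairs, SwitchPattern.nbr, pattern]
  have hW : (pattern n r).weight c = 0 ↔
      (pattern n r).loops c = 0 ∧ (pattern n r).pairs c = 0 := by
    simp [SwitchPattern.weight]
  have hloop : c.toMultidigraph.Loopless ↔ ∀ u, u.1 ≠ (c u).1 := by
    simp only [Multidigraph.Loopless, toMultidigraph, Finset.card_eq_zero,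
      Finset.filter_eq_empty_iff, Finset.mem_univ, true_implies]
    constructor
    · intro h u hu
      exact h u.1 ⟨rfl, hu.symm⟩
    · rintro h i u ⟨h1, h2⟩
      exact h u (h1.trans h2.symm)
  have hpar : c.toMultidigraph.NoParallelArcs ↔
      ∀ u w, u.1 = w.1 → (c u).1 = (c w).1 → u = w := by
    simp only [Multidigraph.NoParallelArcs, toMultidigraph, Finset.card_le_one,
      Finset.mem_filter, Finset.mem_univ, true_and]
    constructor
    · intro h u w h1 h2
      exact h u.1 (c u).1 u ⟨rfl, rfl⟩ w ⟨h1.symm, h2.symm⟩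
    · rintro h i j u ⟨h1, h2⟩ w ⟨h3, h4⟩
      exact h u w (h1.trans h3.symm) (h2.trans h4.symm)
  have hdig : c.toMultidigraph.DigonFree ↔
      ∀ u w, u.1 ≠ (c u).1 → u.1 = (c w).1 → (c u).1 ≠ w.1 := by
    simp only [Multidigraph.DigonFree, toMultidigraph, Finset.card_pos, Finset.Nonempty,
      Finset.mem_filter, Finset.mem_univ, true_and]
    constructor
    · intro h u w h1 h2 h3
      exact h u.1 (c u).1 h1 ⟨⟨u, rfl, rfl⟩, ⟨w, h3.symm, h2.symm⟩⟩
    · rintro h i j hij ⟨⟨u, rfl, rfl⟩, ⟨w, h3, h4⟩⟩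
      exact h u w hij h4.symm h3.symm
  rw [hW, hL, hR, Multidigraph.IsOrientedGraph, Multidigraph.IsSimple, hloop, hpar, hdig,
    and_assoc]
  refine and_congr_right fun h => ?_
  constructor
  · rintro ⟨h1, h2⟩ u w
    refine if_neg ?_
    rintro ⟨-, huw, -, ⟨a, b⟩ | ⟨a, b⟩⟩
    · exact huw (h1 u w a b)
    · exact h2 u w (h u) a b
  · intro h1
    have h2 : ∀ u w, ¬ (u.1 ≠ (c u).1 ∧ u ≠ w ∧ c u ≠ c w ∧
        ((u.1 = w.1 ∧ (c u).1 = (c w).1) ∨ (u.1 = (c w).1 ∧ (c u).1 = w.1))) := by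
      intro u w hh
      have := h1 u w
      rw [clash, if_pos hh] at this
      exact one_ne_zero this
    refine ⟨fun u w a b => ?_, fun u w _ a b => ?_⟩
    · by_contra huw
      exact h2 u w ⟨h u, huw, fun e => huw (c.injective e), Or.inl ⟨a, b⟩⟩
    · have huw : u ≠ w := by
        rintro rfl
        exact h u a
      exact h2 u w ⟨h u, huw, fun e => huw (c.injective e), Or.inr ⟨a, b⟩⟩

lemma model_real_eq_prob (n r : ℕ) :
    (directedConfigurationModel n r).toMeasure.real
      {D : Multidigraph (Fin n) | D.IsOrientedGraph} = (pattern n r).prob 0 := by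
  classical
  rw [Measure.real, PMF.toMeasure_apply_eq_toOuterMeasure_apply _ MeasurableSpace.measurableSet_top,
    directedConfigurationModel, PMF.toOuterMeasure_map_apply,
    PMF.toOuterMeasure_uniformOfFintype_apply, ENNReal.toReal_div, SwitchPattern.prob,
    SwitchPattern.count, ENNReal.toReal_natCast, ENNReal.toReal_natCast]
  congr 2
  · rw [Finset.sum_boole, Fintype.card_subtype, Nat.cast_id]
    congr 1
    ext c
    simp [isOrientedGraph_iff]
  · exact Fintype.card_perm

end DirectedConfiguration

theorem lemma4p1 (r : ℕ) (hr : 0 < r) :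
    Tendsto
      (fun n : ℕ =>
        (directedConfigurationModel n r).toMeasure.real
          {D : Multidigraph (Fin n) | D.IsOrientedGraph})
      atTop (𝓝 (Real.exp (-cycleMean r 1 - cycleMean r 2))) := by
  simp only [DirectedConfiguration.model_real_eq_prob]
  have hcard : Tendsto (fun n => Fintype.card (Fin n × Fin r)) atTop atTop := by
    simp only [Fintype.card_prod, Fintype.card_fin]
    exact tendsto_id.atTop_mul_const' hr
  convert SwitchPattern.tendsto_prob_zero (fun n => DirectedConfiguration.pattern n r) hcard
    using 3
  -- Writing r = s + 1 removes the truncated subtraction in `(r - 1) ^ 2`; what remains is μ₁ + μ₂ =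
  -- r + ((r-1)² + r²)/2.
  obtain ⟨s, rfl⟩ : ∃ s, r = s + 1 := ⟨r - 1, by omega⟩
  simp only [cycleMean, Nat.add_sub_cancel]
  push_cast
  ring
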